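/- There is an absolute constant $C>0$ such that the following holds. Let $n,k\in\mathbb N^+$, $\alpha,\delta\in(0,1)$, and let $m\in\mathbb N$ satisfy $m\ge C\,\frac{\log(nk/\delta)}{\alpha^2}$. Let $\mathcal X,\mathcal Y$ be measurable spaces and let $\phi:\mathcal X\times\mathcal Y\to\Delta_k$ be measurable, where $\Delta_k=\{u\in[0,1]^k:\sum_j u_j=1\}$. Then there is a randomized online estimator, which does not depend on the distribution $D$ or the algorithm $A$ below, with the following property. Let $D$ be a probability distribution on $\mathcal X\times\mathcal Y$, and let $A$ be a (possibly randomized) adaptive algorithm interacting with the estimator in $n$ rounds. The estimator holds one sample $S$ of $m$ independent draws from $D$, shared by all rounds. In round $i=1,\dots,n$, the algorithm $A$ selects an event $E_i\subseteq\mathcal X\times\mathcal Y$ disjoint from $E_1,\dots,E_{i-1}$, as a measurable function of its own internal randomness and of the estimates received in rounds $1,\dots,i-1$. The estimator then reports a vector $\hat e_i\in\mathbb R^k$ computed from $S$, its own internal randomness and $E_1,\dots,E_i$. The internal randomness of $A$, the sample $S$ and the internal randomness of the estimator are independent. Then the reported estimates are random variables, and $$\Pr\Bigl[\exists i\in[n],\,j\in[k]:\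 \bigl|\hat e_{i,j}-\mathbb E_{(x,y)\sim D}\bigl[\phi(x,y)_j\cdot\mathbb I[(x,y)\in E_i]\bigr]\bigr|>\alpha\Bigr]\le\delta,$$ where $\mathbb E_{(x,y)\sim D}$ averages over a fresh draw $(x,y)$ with $E_i$ held fixed. -/

import Mathlib

open MeasureTheory

universe u v w

/-- An adaptive algorithm selecting `n` pairwise disjoint events in `Z`. The event of round `i`
is chosen from the algorithm's own internal randomness `r : R` and the estimates (vectors in `ℝᵏ`)
received in the rounds before `i`; it has no other access to the sample. -/
structure AdaptiveSelector (R Z : Type*) [MeasurableSpace R] [MeasurableSpace Z] (n k : ℕ) where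
  /-- the event selected in round `i`, given the randomness and the estimates of rounds `< i` -/
  select : R → (i : Fin n) → (Fin i.val → Fin k → ℝ) → Set Z
  /-- the selected events are events, depending measurably on randomness and past estimates -/
  measurableSet_select : ∀ i : Fin n,
    MeasurableSet {p : R × (Fin i.val → Fin k → ℝ) × Z | p.2.2 ∈ select p.1 i p.2.1}
  /-- whatever estimates are received, the event of each round is disjoint from the earlier ones -/
  disjoint_select : ∀ (r : R) (a : Fin n → Fin k → ℝ) (i j : Fin n), i < j →
    Disjoint (select r i fun l => a ⟨l, l.isLt.trans i.isLt⟩)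
      (select r j fun l => a ⟨l, l.isLt.trans j.isLt⟩)

/-- A randomized online estimator working from a single sample of size `m`: in round `i` it
reports a vector in `ℝᵏ` computed from its random seed, the sample (the same one in all rounds)
and the events of the rounds `0, …, i`. -/
structure OnlineEstimator (Z : Type*) (n k m : ℕ) where
  /-- random seeds -/
  Seed : Type
  [measurableSpaceSeed : MeasurableSpace Seed]
  /-- the distribution of the seed -/
  seedLaw : Measure Seed
  [isProbabilityMeasure_seedLaw : IsProbabilityMeasure seedLaw]
  /-- the estimates reported in round `i` -/
  answer : Seed → (Fin m → Z) → (i : Fin n) → (Fin (i.val + 1) → Set Z) → Fin k → ℝ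

attribute [instance] OnlineEstimator.measurableSpaceSeed
  OnlineEstimator.isProbabilityMeasure_seedLaw

section Interaction

variable {R Z : Type*} [MeasurableSpace R] [MeasurableSpace Z] {n k m : ℕ}

/-- The vector of estimates reported in round `i` when the selector `A` with randomness `r`
interacts with the estimator `M` with sample `S` and seed `ω`. -/
noncomputable def interactionEstimate (A : AdaptiveSelector R Z n k) (M : OnlineEstimator Z n k m)
    (r : R) (S : Fin m → Z) (ω : M.Seed) (i : Fin n) : Fin k → ℝ :=
  M.answer ω S i fun l =>
    A.select r ⟨l.val, by omega⟩ fun q => interactionEstimate A M r S ω ⟨q.val, by omega⟩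
termination_by i.val
decreasing_by
  exact lt_of_lt_of_le q.isLt (Nat.lt_succ_iff.mp l.isLt)

/-- The event selected in round `i` of the same interaction. -/
noncomputable def interactionEvent (A : AdaptiveSelector R Z n k) (M : OnlineEstimator Z n k m)
    (r : R) (S : Fin m → Z) (ω : M.Seed) (i : Fin n) : Set Z :=
  A.select r i fun q => interactionEstimate A M r S ω ⟨q.val, q.isLt.trans i.isLt⟩

end Interaction

/-! The estimator reports the empirical mean on each selected event plus independent Laplace noise
of scale b. Along a fixed transcript the events are fixed and disjoint, and φ takes values in the
simplex, so replacing one sample point moves the whole n × k array of empirical means by at most 2/m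
in ℓ¹. The likelihood of a transcript then changes by a factor of at most exp ε with ε = 2/(mb),
whatever n and k are.

For fixed randomness of the algorithm, passing from transcript to noise is a triangular shear, which
preserves volume; hence the transcript has an explicit density given S. Exchanging the integrals
over samples and transcripts leaves a fixed transcript, for which Hoeffding's inequality and a union
bound control the bad samples. Cauchy–Schwarz restores the weighting by likelihood
(`measure_transcript_mem_le`). Its cost is governed by the second moment of the likelihood over its
squared mean, at most cosh(ε)^m ≤ exp(mε²/2) by `lintegral_sq_le_cosh_pow_mul_sq`. For ε = α/2 this
is dominated by the Hoeffding gain.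

The argument needs m of order log(2nk/δ)/α². This is comparable to log(nk/δ)/α² unless nk/δ < 2,
which forces n = k = 1 and δ > 1/2. There, either mα² is large enough for failure probability 1/2,
or noise of scale 1/√m succeeds with probability of order α√m, which suffices
(`measure_laplaceFailure_one_le`). -/

open scoped ENNReal

/-! ### Integrals and densities on finite powers of a measure. -/

section ProductMeasures

variable {α : Type*} [MeasurableSpace α] (μ : Measure α) [SigmaFinite μ]

theorem measurable_fin_cons {n : ℕ} :
    Measurable fun p : α × (Fin n → α) => (Fin.cons p.1 p.2 : Fin (n + 1) → α) := by
  refine measurable_pi_lambda _ fun i => ?_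
  refine Fin.cases ?_ (fun i => ?_) i
  · simpa using measurable_fst
  · simp only [Fin.cons_succ]
    fun_prop

theorem lintegral_pi_fin_succ {n : ℕ} {f : (Fin (n + 1) → α) → ℝ≥0∞} (hf : Measurable f) :
    ∫⁻ x, f x ∂Measure.pi (fun _ => μ) =
      ∫⁻ x, ∫⁻ y, f (Fin.cons x y) ∂Measure.pi (fun _ : Fin n => μ) ∂μ := by
  have h := (measurePreserving_piFinSuccAbove (fun _ : Fin (n + 1) => μ) 0).symm
  rw [← h.lintegral_comp hf, lintegral_prod]
  · refine lintegral_congr fun x => lintegral_congr fun y => ?_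
    rw [MeasurableEquiv.piFinSuccAbove_symm_apply]
    simp [Fin.insertNthEquiv]
  · exact (hf.comp (MeasurableEquiv.measurable _)).aemeasurable

theorem lintegral_pi_fin_prod {n : ℕ} {f : Fin n → α → ℝ≥0∞} (hf : ∀ i, Measurable (f i)) :
    ∫⁻ x, ∏ i, f i (x i) ∂Measure.pi (fun _ => μ) = ∏ i, ∫⁻ x, f i x ∂μ := by
  induction n with
  | zero => simp
  | succ n ih =>
    rw [lintegral_pi_fin_succ μ (by fun_prop)]
    simp only [Fin.prod_univ_succ, Fin.cons_zero, Fin.cons_succ]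
    have hmeas : Measurable fun y : Fin n → α => ∏ i, f i.succ (y i) := by fun_prop
    simp_rw [lintegral_const_mul _ hmeas]
    rw [lintegral_mul_const _ (hf 0), ih fun i => hf i.succ]

theorem pi_withDensity_fin {n : ℕ} {f : α → ℝ≥0∞} (hf : Measurable f)
    [SigmaFinite (μ.withDensity f)] :
    Measure.pi (fun _ : Fin n => μ.withDensity f) =
      (Measure.pi fun _ => μ).withDensity fun x => ∏ i, f (x i) := by
  refine Measure.pi_eq fun s hs => ?_
  have hind : ∀ x : Fin n → α, (Set.univ.pi s).indicator (fun x => ∏ i, f (x i)) x =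
      ∏ i, (s i).indicator f (x i) := fun x => by
    by_cases hx : x ∈ Set.univ.pi s
    · rw [Set.indicator_of_mem hx]
      exact Finset.prod_congr rfl fun i _ => (Set.indicator_of_mem (hx i trivial) _).symm
    · rw [Set.indicator_of_notMem hx]
      simp only [Set.mem_pi, not_forall] at hx
      obtain ⟨i, _, hi⟩ := hx
      exact (Finset.prod_eq_zero (Finset.mem_univ i) (Set.indicator_of_notMem hi _)).symm
  rw [withDensity_apply _ (MeasurableSet.univ_pi hs), ← lintegral_indicator (.univ_pi hs)]
  simp_rw [hind]
  rw [lintegral_pi_fin_prod μ fun i => hf.indicator (hs i)]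
  exact Finset.prod_congr rfl fun i _ => by
    rw [lintegral_indicator (hs i), withDensity_apply _ (hs i)]

end ProductMeasures

/-! ### Volume preservation by triangular shears. -/

section TriangularShear

/-- The map `a ↦ (aᵢ - gᵢ(a₀, …, aᵢ₋₁))ᵢ`. -/
def triangularShear {V : Type*} [Sub V] {n : ℕ} (g : (i : Fin n) → (Fin i.val → V) → V)
    (a : Fin n → V) (i : Fin n) : V :=
  a i - g i fun q => a ⟨q, q.isLt.trans i.isLt⟩

variable {V : Type*} [AddCommGroup V] [MeasurableSpace V] [MeasurableSub₂ V]

/-- Once the earlier coordinates are fixed, each coordinate is merely translated. Splitting off the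
last coordinate leaves a shear of the others, and the full map is a skew product over it with
translations as fibre maps. -/
theorem measurePreserving_triangularShear [MeasurableAdd V] (μ : Measure V) [SigmaFinite μ]
    [μ.IsAddRightInvariant] {n : ℕ} {g : (i : Fin n) → (Fin i.val → V) → V}
    (hg : ∀ i, Measurable (g i)) :
    MeasurePreserving (triangularShear g) (Measure.pi fun _ => μ) (Measure.pi fun _ => μ) := by
  induction n with
  | zero =>
    have : triangularShear g = id := by
      funext a; exact Subsingleton.elim _ _
    rw [this]; exact MeasurePreserving.id _
  | succ n ih =>
    have e := measurePreserving_piFinSuccAbove (fun _ : Fin (n + 1) => μ) (Fin.last n)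
    have hskew : MeasurePreserving
        (fun p : (Fin n → V) × V =>
          (triangularShear (fun i : Fin n => g i.castSucc) p.1, p.2 - g (Fin.last n) p.1))
        ((Measure.pi fun _ => μ).prod μ) ((Measure.pi fun _ => μ).prod μ) := by
      refine (ih fun i => hg i.castSucc).skew_product
        (g := fun x y => y - g (Fin.last n) x) ?_ (ae_of_all _ fun x => ?_)
      · exact measurable_snd.sub ((hg (Fin.last n)).comp measurable_fst)
      · exact (measurePreserving_sub_right μ (g (Fin.last n) x)).map_eq
    have hswap := Measure.measurePreserving_swap (μ := μ) (ν := Measure.pi fun _ : Fin n => μ)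
    have hswap' := Measure.measurePreserving_swap (μ := Measure.pi fun _ : Fin n => μ) (ν := μ)
    have key := ((e.symm.comp hswap').comp hskew).comp (hswap.comp e)
    convert key using 1
    funext a i
    refine Fin.lastCases ?_ (fun i => ?_) i
    · simp [triangularShear, MeasurableEquiv.piFinSuccAbove, Fin.insertNthEquiv]
      rfl
    · simp [triangularShear, MeasurableEquiv.piFinSuccAbove, Fin.insertNthEquiv]
      rfl

end TriangularShear

/-! ### Second moments of functions with bounded ratios, and reweighting by Cauchy–Schwarz. -/

section SecondMoment

/-- For finite values, expand (e^ε y − x)(e^ε x − y) ≥ 0 and multiply by e^(−ε). If one value is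
infinite, so is the other. -/
theorem ENNReal.sq_add_sq_le_cosh_mul {ε : ℝ} {x y : ℝ≥0∞}
    (hxy : x ≤ ENNReal.ofReal (Real.exp ε) * y) (hyx : y ≤ ENNReal.ofReal (Real.exp ε) * x) :
    x ^ 2 + y ^ 2 ≤ 2 * ENNReal.ofReal (Real.cosh ε) * (x * y) := by
  have hM : 0 < Real.exp ε := Real.exp_pos ε
  have hc : 0 < Real.cosh ε := Real.cosh_pos ε
  by_cases hx : x = ∞
  · have hy : y = ∞ := by
      by_contra hy
      rw [hx, top_le_iff] at hxy
      exact ENNReal.mul_ne_top ENNReal.ofReal_ne_top hy hxy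
    subst hx hy
    simp [ENNReal.mul_top, hc]
  by_cases hy : y = ∞
  · rw [hy, top_le_iff] at hyx
    exact absurd hyx (ENNReal.mul_ne_top ENNReal.ofReal_ne_top hx)
  lift x to NNReal using hx
  lift y to NNReal using hy
  have hx' : (x : ℝ) ≤ Real.exp ε * y := by
    have := ENNReal.toReal_mono (by finiteness) hxy
    simpa [hM.le] using this
  have hy' : (y : ℝ) ≤ Real.exp ε * x := by
    have := ENNReal.toReal_mono (by finiteness) hyx
    simpa [hM.le] using this
  have hreal : (x : ℝ) ^ 2 + y ^ 2 ≤ 2 * Real.cosh ε * (x * y) := by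
    have hinv : Real.exp ε * Real.exp (-ε) = 1 := by rw [← Real.exp_add]; simp
    have hp : 0 < Real.exp (-ε) := Real.exp_pos _
    have h1 : 0 ≤ (Real.exp ε * y - x) * (Real.exp ε * x - y) :=
      mul_nonneg (sub_nonneg.2 hx') (sub_nonneg.2 hy')
    have h2 := mul_nonneg hp.le h1
    rw [Real.cosh_eq]
    have h3 : Real.exp (-ε) * ((Real.exp ε * y - x) * (Real.exp ε * x - y)) =
        (Real.exp ε * Real.exp (-ε)) * Real.exp ε * (x * y)
          - (Real.exp ε * Real.exp (-ε)) * (x ^ 2 + y ^ 2) + Real.exp (-ε) * (x * y) := by ring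
    rw [h3, hinv] at h2
    linarith
  rw [← ENNReal.ofReal_coe_nnreal, ← ENNReal.ofReal_coe_nnreal, ← ENNReal.ofReal_pow (by positivity),
    ← ENNReal.ofReal_pow (by positivity), ← ENNReal.ofReal_add (by positivity) (by positivity),
    ← ENNReal.ofReal_mul (by positivity), ← ENNReal.ofReal_ofNat 2,
    ← ENNReal.ofReal_mul (by positivity), ← ENNReal.ofReal_mul (by positivity)]
  exact ENNReal.ofReal_le_ofReal hreal

/-- Integrate the pointwise inequality over two independent copies. The constant cosh ε is 1 +
O(ε²), whereas bounding f by exp ε times its mean would cost a factor of first order in ε, too much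
once raised to the power m. -/
theorem lintegral_sq_le_cosh_mul_sq {Ω : Type*} [MeasurableSpace Ω] (μ : Measure Ω)
    [IsProbabilityMeasure μ] {f : Ω → ℝ≥0∞} (hf : Measurable f) {ε : ℝ}
    (hε : ∀ x y, f x ≤ ENNReal.ofReal (Real.exp ε) * f y) :
    ∫⁻ x, f x ^ 2 ∂μ ≤ ENNReal.ofReal (Real.cosh ε) * (∫⁻ x, f x ∂μ) ^ 2 := by
  have h1 : ∫⁻ x, ∫⁻ y, (f x ^ 2 + f y ^ 2) ∂μ ∂μ = 2 * ∫⁻ x, f x ^ 2 ∂μ := by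
    simp_rw [lintegral_add_left measurable_const, lintegral_const, measure_univ, mul_one]
    rw [lintegral_add_left (hf.pow_const 2)]
    simp [two_mul]
  have h2 : ∫⁻ x, ∫⁻ y, 2 * ENNReal.ofReal (Real.cosh ε) * (f x * f y) ∂μ ∂μ =
      2 * (ENNReal.ofReal (Real.cosh ε) * (∫⁻ x, f x ∂μ) ^ 2) := by
    simp_rw [lintegral_const_mul _ (hf.const_mul _), lintegral_const_mul _ hf]
    rw [lintegral_const_mul _ (hf.mul_const _), lintegral_mul_const _ hf]
    ring
  have h3 : 2 * ∫⁻ x, f x ^ 2 ∂μ ≤ 2 * (ENNReal.ofReal (Real.cosh ε) * (∫⁻ x, f x ∂μ) ^ 2) := by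
    rw [← h1, ← h2]
    exact lintegral_mono fun x => lintegral_mono fun y =>
      ENNReal.sq_add_sq_le_cosh_mul (hε x y) (hε y x)
  exact (ENNReal.mul_le_mul_iff_right (by simp) (by simp)).1 h3

/-- A positive function on a product of probability spaces whose value changes by a factor of at
most `exp ε` when one coordinate is changed has a second moment close to its squared mean. -/
theorem lintegral_sq_le_cosh_pow_mul_sq {Ω : Type*} [MeasurableSpace Ω] (μ : Measure Ω)
    [IsProbabilityMeasure μ] {ε : ℝ} {m : ℕ} {f : (Fin m → Ω) → ℝ≥0∞} (hf : Measurable f)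
    (hε : ∀ x s z, f x ≤ ENNReal.ofReal (Real.exp ε) * f (Function.update x s z)) :
    ∫⁻ x, f x ^ 2 ∂Measure.pi (fun _ => μ) ≤
      ENNReal.ofReal (Real.cosh ε) ^ m * (∫⁻ x, f x ∂Measure.pi fun _ => μ) ^ 2 := by
  induction m with
  | zero => simp [Measure.pi_of_empty (fun _ : Fin 0 => μ) finZeroElim]
  | succ m ih =>
    have hcons : Measurable fun p : Ω × (Fin m → Ω) => f (Fin.cons p.1 p.2) :=
      hf.comp measurable_fin_cons
    rw [lintegral_pi_fin_succ μ (hf.pow_const 2), lintegral_pi_fin_succ μ hf]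
    calc ∫⁻ x, ∫⁻ y, f (Fin.cons x y) ^ 2 ∂Measure.pi (fun _ => μ) ∂μ
        ≤ ∫⁻ x, ENNReal.ofReal (Real.cosh ε) ^ m *
            (∫⁻ y, f (Fin.cons x y) ∂Measure.pi fun _ => μ) ^ 2 ∂μ := by
          refine lintegral_mono fun x => ih (hcons.comp measurable_prodMk_left) fun y s z => ?_
          have := hε (Fin.cons x y) s.succ z
          rwa [← Fin.cons_update] at this
      _ = ENNReal.ofReal (Real.cosh ε) ^ m *
            ∫⁻ x, (∫⁻ y, f (Fin.cons x y) ∂Measure.pi fun _ => μ) ^ 2 ∂μ :=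
          lintegral_const_mul _ (hcons.lintegral_prod_right'.pow_const 2)
      _ ≤ ENNReal.ofReal (Real.cosh ε) ^ m * (ENNReal.ofReal (Real.cosh ε) *
            (∫⁻ x, ∫⁻ y, f (Fin.cons x y) ∂Measure.pi (fun _ => μ) ∂μ) ^ 2) := by
          gcongr
          -- Integrating out the other coordinates preserves the ratio bound in the first one.
          refine lintegral_sq_le_cosh_mul_sq μ hcons.lintegral_prod_right' fun x x' => ?_
          rw [← lintegral_const_mul _ (show Measurable fun y => f (Fin.cons x' y) from
            hcons.comp measurable_prodMk_left)]
          refine lintegral_mono fun y => ?_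
          have := hε (Fin.cons x y) 0 x'
          rwa [Fin.update_cons_zero] at this
      _ = _ := by rw [pow_succ (ENNReal.ofReal _), mul_assoc]

theorem lintegral_indicator_mul_le_sqrt {Ω : Type*} [MeasurableSpace Ω] (μ : Measure Ω)
    {s : Set Ω} (hs : MeasurableSet s) {f : Ω → ℝ≥0∞} (hf : Measurable f) {p K : ℝ≥0∞}
    (hp : μ s ≤ p ^ 2) (hK : ∫⁻ x, f x ^ 2 ∂μ ≤ (K * ∫⁻ x, f x ∂μ) ^ 2) :
    ∫⁻ x, s.indicator 1 x * f x ∂μ ≤ p * K * ∫⁻ x, f x ∂μ := by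
  have h := ENNReal.lintegral_mul_le_Lp_mul_Lq μ Real.HolderConjugate.two_two
    (f := s.indicator 1) (g := f) (measurable_one.indicator hs).aemeasurable hf.aemeasurable
  refine h.trans ?_
  have hroot : ∀ x : ℝ≥0∞, (x ^ 2) ^ (1 / 2 : ℝ) = x := fun x => by
    rw [← ENNReal.rpow_natCast, ← ENNReal.rpow_mul]; norm_num
  have h1 : ∫⁻ x, s.indicator (1 : Ω → ℝ≥0∞) x ^ (2 : ℝ) ∂μ = μ s := by
    rw [← lintegral_indicator_one hs]
    refine lintegral_congr fun x => ?_
    by_cases hx : x ∈ s <;> simp [hx]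
  rw [h1, mul_assoc]
  refine mul_le_mul' ?_ ?_
  · calc μ s ^ (1 / 2 : ℝ) ≤ (p ^ 2) ^ (1 / 2 : ℝ) := by gcongr
      _ = p := hroot p
  · simp only [ENNReal.rpow_ofNat]
    calc (∫⁻ x, f x ^ 2 ∂μ) ^ (1 / 2 : ℝ) ≤ ((K * ∫⁻ x, f x ∂μ) ^ 2) ^ (1 / 2 : ℝ) := by gcongr
      _ = _ := hroot _

end SecondMoment

/-! ### Hoeffding's inequality for empirical means. -/

section Hoeffding

theorem measure_mean_sub_integral_le {Z : Type*} [MeasurableSpace Z] (D : Measure Z)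
    [IsProbabilityMeasure D] {g : Z → ℝ} (hg : Measurable g) (h01 : ∀ z, g z ∈ Set.Icc (0 : ℝ) 1)
    {m : ℕ} (hm : 0 < m) {t : ℝ} (ht : 0 ≤ t) :
    (Measure.pi fun _ : Fin m => D) {S | t ≤ (∑ s, g (S s)) / m - ∫ z, g z ∂D} ≤
      ENNReal.ofReal (Real.exp (-(2 * m * t ^ 2))) := by
  have hind : ProbabilityTheory.iIndepFun (fun (s : Fin m) (S : Fin m → Z) => g (S s) - ∫ z, g z ∂D)
      (Measure.pi fun _ : Fin m => D) :=
    ProbabilityTheory.iIndepFun_pi (X := fun _ z => g z - ∫ z, g z ∂D)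
      fun _ => (hg.sub_const _).aemeasurable
  have hsub : ∀ s : Fin m, ProbabilityTheory.HasSubgaussianMGF
      (fun S : Fin m → Z => g (S s) - ∫ z, g z ∂D) ((‖(1 : ℝ) - 0‖₊ / 2) ^ 2)
      (Measure.pi fun _ : Fin m => D) := fun s => by
    have hint : ∫ S : Fin m → Z, g (S s) ∂(Measure.pi fun _ : Fin m => D) = ∫ z, g z ∂D :=
      integral_comp_eval (μ := fun _ : Fin m => D) hg.aestronglyMeasurable
    rw [← hint]
    exact ProbabilityTheory.hasSubgaussianMGF_of_mem_Icc
      (hg.comp (measurable_pi_apply s)).aemeasurable (ae_of_all _ fun S => h01 _)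
  have h := ProbabilityTheory.HasSubgaussianMGF.measure_sum_ge_le_of_iIndepFun hind
    (s := Finset.univ) (fun s _ => hsub s) (ε := m * t) (by positivity)
  have hset : {S : Fin m → Z | t ≤ (∑ s, g (S s)) / m - ∫ z, g z ∂D} =
      {S | m * t ≤ ∑ s, (g (S s) - ∫ z, g z ∂D)} := by
    ext S
    have hm' : (0 : ℝ) < m := by exact_mod_cast hm
    simp only [Set.mem_ofPred_eq, Finset.sum_sub_distrib, Finset.sum_const, Finset.card_univ,
      Fintype.card_fin, nsmul_eq_mul]
    rw [le_sub_iff_add_le, le_div_iff₀ hm', le_sub_iff_add_le]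
    ring_nf
  rw [hset, ← ENNReal.ofReal_toReal (measure_ne_top _ _)]
  refine ENNReal.ofReal_le_ofReal (h.trans (Real.exp_le_exp.2 (le_of_eq ?_)))
  have hm' : (m : ℝ) ≠ 0 := by exact_mod_cast hm.ne'
  simp
  field_simp

theorem measure_abs_mean_sub_integral_le {Z : Type*} [MeasurableSpace Z] (D : Measure Z)
    [IsProbabilityMeasure D] {g : Z → ℝ} (hg : Measurable g) (h01 : ∀ z, g z ∈ Set.Icc (0 : ℝ) 1)
    {m : ℕ} (hm : 0 < m) {t : ℝ} (ht : 0 ≤ t) :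
    (Measure.pi fun _ : Fin m => D) {S | t < |(∑ s, g (S s)) / m - ∫ z, g z ∂D|} ≤
      ENNReal.ofReal (2 * Real.exp (-(2 * m * t ^ 2))) := by
  have hm' : (m : ℝ) ≠ 0 := by exact_mod_cast hm.ne'
  have h1 := measure_mean_sub_integral_le D hg h01 hm ht
  -- The lower tail of g is the upper tail of 1 − g, which again takes values in [0, 1].
  have h2 := measure_mean_sub_integral_le D (g := fun z => 1 - g z) (measurable_const.sub hg)
    (fun z => ⟨by linarith [(h01 z).2], by linarith [(h01 z).1]⟩) hm ht
  have hint : Integrable g D := Integrable.of_mem_Icc 0 1 hg.aemeasurable (ae_of_all _ h01)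
  rw [integral_sub (integrable_const _) hint] at h2
  calc _ ≤ (Measure.pi fun _ : Fin m => D) ({S | t ≤ (∑ s, g (S s)) / m - ∫ z, g z ∂D} ∪
        {S | t ≤ (∑ s, (1 - g (S s))) / m - (∫ _, (1 : ℝ) ∂D - ∫ z, g z ∂D)}) := by
        refine measure_mono fun S hS => ?_
        rcases lt_abs.1 (Set.mem_ofPred_eq.mp hS) with h | h
        · exact Or.inl h.le
        · refine Or.inr ?_
          simp only [Set.mem_ofPred_eq, Finset.sum_sub_distrib, sub_div]
          simp [hm']
          linarith
    _ ≤ _ := (measure_union_le _ _).trans (add_le_add h1 h2)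
    _ = _ := by rw [← ENNReal.ofReal_add (by positivity) (by positivity)]; ring_nf

end Hoeffding

/-! ### The Laplace distribution. -/

section Laplace

/-- The density of the centred Laplace distribution of scale `b`. -/
noncomputable def laplacePDF (b x : ℝ) : ℝ := Real.exp (-|x| / b) / (2 * b)

/-- The centred Laplace distribution of scale `b`. -/
noncomputable def laplaceMeasure (b : ℝ) : Measure ℝ :=
  volume.withDensity fun x => ENNReal.ofReal (laplacePDF b x)

theorem laplacePDF_nonneg {b : ℝ} (hb : 0 < b) (x : ℝ) : 0 ≤ laplacePDF b x := by
  unfold laplacePDF; positivity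

theorem measurable_laplacePDF (b : ℝ) : Measurable (laplacePDF b) := by
  unfold laplacePDF; fun_prop

theorem integral_laplacePDF {b : ℝ} (hb : 0 < b) : ∫ x, laplacePDF b x = 1 := by
  unfold laplacePDF
  rw [integral_div]
  have h : ∫ x : ℝ, Real.exp (-|x| / b) = 2 * b := by
    rw [integral_comp_abs (f := fun x => Real.exp (-x / b))]
    have := integral_exp_mul_Ioi (a := -b⁻¹) (by simpa using hb) 0
    simp only [neg_mul, mul_zero, Real.exp_zero] at this
    have h2 : ∀ x : ℝ, -x / b = -(b⁻¹ * x) := fun x => by ring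
    simp_rw [h2, this]
    field_simp
  rw [h, div_self (by positivity)]

theorem lintegral_laplacePDF {b : ℝ} (hb : 0 < b) :
    ∫⁻ x, ENNReal.ofReal (laplacePDF b x) = 1 := by
  have hi : Integrable (laplacePDF b) := by
    by_contra h
    have := integral_laplacePDF hb
    rw [integral_undef h] at this
    exact zero_ne_one this
  rw [← ofReal_integral_eq_lintegral_ofReal hi (ae_of_all _ (laplacePDF_nonneg hb)),
    integral_laplacePDF hb, ENNReal.ofReal_one]

theorem isProbabilityMeasure_laplaceMeasure {b : ℝ} (hb : 0 < b) :
    IsProbabilityMeasure (laplaceMeasure b) :=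
  ⟨by rw [laplaceMeasure, withDensity_apply _ MeasurableSet.univ, Measure.restrict_univ,
    lintegral_laplacePDF hb]⟩

/-- Where |x| > t, the density of scale b is at most 2 exp(−t/(2b)) times the density of scale 2b,
whose mass is one. Half the exponent is lost, but no tail integral has to be computed. -/
theorem laplaceMeasure_abs_gt_le {b : ℝ} (hb : 0 < b) (t : ℝ) :
    laplaceMeasure b {x | t < |x|} ≤ ENNReal.ofReal (2 * Real.exp (-(t / (2 * b)))) := by
  rw [laplaceMeasure, withDensity_apply _ (show MeasurableSet {x : ℝ | t < |x|} from
    measurableSet_lt measurable_const measurable_norm)]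
  calc _ ≤ ∫⁻ x in {x : ℝ | t < |x|}, ENNReal.ofReal (2 * Real.exp (-(t / (2 * b)))) *
        ENNReal.ofReal (laplacePDF (2 * b) x) := by
        refine setLIntegral_mono
          ((measurable_laplacePDF _).ennreal_ofReal.const_mul _) fun x hx => ?_
        rw [← ENNReal.ofReal_mul (by positivity)]
        refine ENNReal.ofReal_le_ofReal ?_
        unfold laplacePDF
        have hx' : t < |x| := hx
        have : Real.exp (-|x| / b) ≤ Real.exp (-(t / (2 * b))) * Real.exp (-|x| / (2 * b)) := by
          rw [← Real.exp_add, Real.exp_le_exp]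
          rw [← sub_nonneg]
          have : -(t / (2 * b)) + -|x| / (2 * b) - -|x| / b = (|x| - t) / (2 * b) := by
            field_simp; ring
          rw [this]
          exact div_nonneg (by linarith) (by positivity)
        calc _ ≤ _ := div_le_div_of_nonneg_right this (by positivity)
          _ = _ := by field_simp
    _ ≤ ∫⁻ x, ENNReal.ofReal (2 * Real.exp (-(t / (2 * b)))) *
        ENNReal.ofReal (laplacePDF (2 * b) x) := setLIntegral_le_lintegral _ _
    _ = _ := by
        rw [lintegral_const_mul _ (measurable_laplacePDF _).ennreal_ofReal,
          lintegral_laplacePDF (by positivity), mul_one]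

end Laplace

/-! ### Transfer from fixed to adaptively produced transcripts. -/

section Transfer

variable {Z V : Type*} [MeasurableSpace Z] [AddCommGroup V] [MeasureSpace V]
  [MeasurableSub₂ V] [MeasurableAdd V] [SigmaFinite (volume : Measure V)]
  [(volume : Measure V).IsAddRightInvariant]

/-- Transfer for adaptive transcripts with additive noise. If changing one sample point changes
the likelihood of every transcript by a factor of at most `exp ε`, then a set of pairs of a sample
and a transcript whose sections at a fixed transcript are unlikely is unlikely also when the
transcript is produced from the sample. -/
theorem measure_transcript_mem_le {n m : ℕ} (D : Measure Z) [IsProbabilityMeasure D]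
    {g : (Fin m → Z) → (i : Fin n) → (Fin i.val → V) → V}
    (hg : ∀ i, Measurable fun p : (Fin m → Z) × (Fin i.val → V) => g p.1 i p.2)
    {f : (Fin n → V) → ℝ≥0∞} (hf : Measurable f) (hf1 : ∫⁻ ω, f ω = 1) {ε : ℝ}
    (hε : ∀ a S s z, f (triangularShear (g S) a) ≤
      ENNReal.ofReal (Real.exp ε) * f (triangularShear (g (Function.update S s z)) a))
    {T : (Fin m → Z) → (Fin n → V) → Fin n → V}
    (hT : Measurable fun p : (Fin m → Z) × (Fin n → V) => T p.1 p.2)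
    (hTg : ∀ S a, T S (triangularShear (g S) a) = a)
    {G : Set ((Fin m → Z) × (Fin n → V))} (hG : MeasurableSet G) {p K : ℝ≥0∞}
    (hp : ∀ a, (Measure.pi fun _ => D) {S | (S, a) ∈ G} ≤ p ^ 2)
    (hK : ENNReal.ofReal (Real.cosh ε) ^ m ≤ K ^ 2) :
    ((Measure.pi fun _ => D).prod (volume.withDensity f)) {q | (q.1, T q.1 q.2) ∈ G} ≤ p * K := by
  have hshear : Measurable fun q : (Fin m → Z) × (Fin n → V) => triangularShear (g q.1) q.2 := by
    refine measurable_pi_lambda _ fun i => ?_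
    have hpre : Measurable fun q : (Fin m → Z) × (Fin n → V) =>
        (q.1, fun l : Fin i.val => q.2 ⟨l, l.isLt.trans i.isLt⟩) := by fun_prop
    exact ((measurable_pi_apply i).comp measurable_snd).sub ((hg i).comp hpre)
  have hgS : ∀ S i, Measurable (g S i) := fun S i => (hg i).comp measurable_prodMk_left
  have hpres : ∀ S, MeasurePreserving (triangularShear (g S)) := fun S =>
    measurePreserving_triangularShear volume (hgS S)
  have hB : MeasurableSet {q : (Fin m → Z) × (Fin n → V) | (q.1, T q.1 q.2) ∈ G} :=
    hG.preimage (measurable_fst.prodMk hT)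
  have hlik : Measurable fun q : (Fin m → Z) × (Fin n → V) => f (triangularShear (g q.1) q.2) :=
    hf.comp hshear
  have hone : Measurable (G.indicator (1 : (Fin m → Z) × (Fin n → V) → ℝ≥0∞)) :=
    measurable_one.indicator hG
  have hfin : SFinite ((volume : Measure (Fin n → V)).withDensity f) := inferInstance
  calc ((Measure.pi fun _ => D).prod (volume.withDensity f)) {q | (q.1, T q.1 q.2) ∈ G}
      = ∫⁻ S, ∫⁻ a, G.indicator 1 (S, a) * f (triangularShear (g S) a)
          ∂volume ∂(Measure.pi fun _ => D) := by
        rw [Measure.prod_apply hB]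
        refine lintegral_congr fun S => ?_
        have hBS : MeasurableSet {ω | (S, T S ω) ∈ G} := hB.preimage measurable_prodMk_left
        have hi : Measurable ({ω | (S, T S ω) ∈ G}.indicator (1 : (Fin n → V) → ℝ≥0∞)) :=
          measurable_one.indicator hBS
        change (volume.withDensity f) {ω | (S, T S ω) ∈ G} = _
        -- Substitute ω = `triangularShear (g S) a`. Since `T S` undoes the shear, the transcript a
        -- becomes the variable of integration.
        rw [← lintegral_indicator_one hBS, lintegral_withDensity_eq_lintegral_mul _ hf hi,
          ← (hpres S).lintegral_comp (hf.mul hi)]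
        refine lintegral_congr fun a => ?_
        rw [Pi.mul_apply, mul_comm]
        congr 1
        by_cases ha : (S, a) ∈ G
        · rw [Set.indicator_of_mem ha, Set.indicator_of_mem (by simpa [hTg] using ha)]
          rfl
        · rw [Set.indicator_of_notMem ha, Set.indicator_of_notMem (by simpa [hTg] using ha)]
    -- With a outside, adaptivity is gone: the inner integral concerns a section of G at a fixed
    -- transcript, and the dependence on S survives only in the likelihood weight.
    _ = ∫⁻ a, ∫⁻ S, G.indicator 1 (S, a) * f (triangularShear (g S) a)
          ∂(Measure.pi fun _ => D) := lintegral_lintegral_swap (hone.mul hlik).aemeasurable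
    _ ≤ ∫⁻ a, p * K * ∫⁻ S, f (triangularShear (g S) a) ∂(Measure.pi fun _ => D) := by
        refine lintegral_mono fun a => ?_
        have hGa : MeasurableSet {S | (S, a) ∈ G} := hG.preimage measurable_prodMk_right
        have hla : Measurable fun S => f (triangularShear (g S) a) :=
          hlik.comp measurable_prodMk_right
        refine lintegral_indicator_mul_le_sqrt _ hGa hla (hp a) ?_
        refine (lintegral_sq_le_cosh_pow_mul_sq D hla (hε a)).trans ?_
        rw [mul_pow]
        gcongr
    _ = p * K * ∫⁻ S, ∫⁻ a, f (triangularShear (g S) a) ∂volume ∂(Measure.pi fun _ => D) := by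
        rw [lintegral_const_mul _ hlik.lintegral_prod_left']
        congr 1
        exact (lintegral_lintegral_swap
          (f := fun S a => f (triangularShear (g S) a)) hlik.aemeasurable).symm
    _ = p * K := by
        -- For each sample the likelihood integrates to one over all transcripts.
        simp_rw [fun S => (hpres S).lintegral_comp hf, hf1]
        simp

end Transfer

/-! ### Arrays of independent Laplace noise. -/

section LaplaceVector

variable {n k : ℕ}

/-- The law of an `n × k` array of independent centred Laplace variables of scale `b`. -/
noncomputable def laplaceNoise (n k : ℕ) (b : ℝ) : Measure (Fin n → Fin k → ℝ) :=
  Measure.pi fun _ => Measure.pi fun _ => laplaceMeasure b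

/-- The density of `laplaceNoise`. -/
noncomputable def laplaceNoisePDF (b : ℝ) (ω : Fin n → Fin k → ℝ) : ℝ≥0∞ :=
  ∏ i, ∏ j, ENNReal.ofReal (laplacePDF b (ω i j))

theorem measurable_laplaceNoisePDF (b : ℝ) :
    Measurable (laplaceNoisePDF b : (Fin n → Fin k → ℝ) → ℝ≥0∞) := by
  have := measurable_laplacePDF b
  unfold laplaceNoisePDF
  fun_prop

theorem isProbabilityMeasure_laplaceNoise {b : ℝ} (hb : 0 < b) :
    IsProbabilityMeasure (laplaceNoise n k b) := by
  have := isProbabilityMeasure_laplaceMeasure hb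
  unfold laplaceNoise
  infer_instance

theorem laplaceNoise_eq_withDensity {b : ℝ} (hb : 0 < b) :
    laplaceNoise n k b = volume.withDensity (laplaceNoisePDF b) := by
  have := isProbabilityMeasure_laplaceMeasure hb
  have h : SigmaFinite ((volume : Measure ℝ).withDensity
      fun x => ENNReal.ofReal (laplacePDF b x)) :=
    inferInstanceAs (SigmaFinite (laplaceMeasure b))
  have hm := (measurable_laplacePDF b).ennreal_ofReal
  have hrow : (Measure.pi fun _ : Fin k => laplaceMeasure b) =
      (volume : Measure (Fin k → ℝ)).withDensity
        fun x => ∏ j, ENNReal.ofReal (laplacePDF b (x j)) :=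
    pi_withDensity_fin volume hm
  have h' : SigmaFinite ((volume : Measure (Fin k → ℝ)).withDensity
      fun x => ∏ j, ENNReal.ofReal (laplacePDF b (x j))) := by
    rw [← hrow]; infer_instance
  unfold laplaceNoise
  rw [hrow]
  exact pi_withDensity_fin (n := n) volume
    (Finset.measurable_fun_prod _ fun j _ => hm.comp (measurable_pi_apply j))

theorem lintegral_laplaceNoisePDF {b : ℝ} (hb : 0 < b) :
    ∫⁻ ω : Fin n → Fin k → ℝ, laplaceNoisePDF b ω = 1 := by
  have := isProbabilityMeasure_laplaceNoise (n := n) (k := k) hb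
  have h := measure_univ (μ := laplaceNoise n k b)
  rwa [laplaceNoise_eq_withDensity hb, withDensity_apply _ .univ, Measure.restrict_univ] at h

/-- The logarithm of the Laplace density is 1/b-Lipschitz, so for a product of such densities only
the ℓ¹ distance of the arrays matters. -/
theorem laplaceNoisePDF_le_exp_mul {b ε : ℝ} (hb : 0 < b) {x y : Fin n → Fin k → ℝ}
    (h : ∑ i, ∑ j, |x i j - y i j| ≤ ε * b) :
    laplaceNoisePDF b x ≤ ENNReal.ofReal (Real.exp ε) * laplaceNoisePDF b y := by
  have hpt : ∀ u v : ℝ, ENNReal.ofReal (laplacePDF b u) ≤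
      ENNReal.ofReal (Real.exp (|u - v| / b)) * ENNReal.ofReal (laplacePDF b v) := fun u v => by
    rw [← ENNReal.ofReal_mul (Real.exp_nonneg _)]
    refine ENNReal.ofReal_le_ofReal ?_
    unfold laplacePDF
    rw [← mul_div_assoc, ← Real.exp_add, ← add_div]
    have : |v| - |u| ≤ |u - v| := by rw [abs_sub_comm]; exact abs_sub_abs_le_abs_sub v u
    gcongr
    linarith
  calc laplaceNoisePDF b x
      ≤ ∏ i, ∏ j, (ENNReal.ofReal (Real.exp (|x i j - y i j| / b)) *
          ENNReal.ofReal (laplacePDF b (y i j))) :=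
        Finset.prod_le_prod' fun i _ => Finset.prod_le_prod' fun j _ => hpt _ _
    _ = ENNReal.ofReal (Real.exp ((∑ i, ∑ j, |x i j - y i j|) / b)) * laplaceNoisePDF b y := by
        simp_rw [Finset.prod_mul_distrib, Finset.sum_div, Real.exp_sum, laplaceNoisePDF]
        rw [ENNReal.ofReal_prod_of_nonneg fun i _ => by positivity]
        congr 1
        exact Finset.prod_congr rfl fun i _ =>
          (ENNReal.ofReal_prod_of_nonneg fun j _ => by positivity).symm
    _ ≤ _ := by
        gcongr
        rwa [div_le_iff₀ hb]

theorem laplaceNoise_apply_mem {b : ℝ} (hb : 0 < b) (i : Fin n) (j : Fin k) {s : Set ℝ}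
    (hs : MeasurableSet s) : laplaceNoise n k b {ω | ω i j ∈ s} = laplaceMeasure b s := by
  have := isProbabilityMeasure_laplaceMeasure hb
  have h := (measurePreserving_eval (fun _ : Fin k => laplaceMeasure b) j).comp
    (measurePreserving_eval (fun _ : Fin n => Measure.pi fun _ : Fin k => laplaceMeasure b) i)
  exact h.measure_preimage hs.nullMeasurableSet

theorem laplaceNoise_exists_abs_gt_le {b : ℝ} (hb : 0 < b) (t : ℝ) :
    laplaceNoise n k b {ω | ∃ i j, t < |ω i j|} ≤
      ENNReal.ofReal (2 * (n * k) * Real.exp (-(t / (2 * b)))) := by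
  have hset : {ω : Fin n → Fin k → ℝ | ∃ i j, t < |ω i j|} =
      ⋃ i, ⋃ j, {ω | ω i j ∈ {x : ℝ | t < |x|}} := by
    ext ω; simp
  have hs : MeasurableSet {x : ℝ | t < |x|} := measurableSet_lt measurable_const measurable_norm
  rw [hset]
  calc _ ≤ ∑ i : Fin n, ∑ j : Fin k, laplaceNoise n k b {ω | ω i j ∈ {x : ℝ | t < |x|}} :=
        (measure_iUnion_fintype_le _ _).trans
          (Finset.sum_le_sum fun i _ => measure_iUnion_fintype_le _ _)
    _ ≤ ∑ i : Fin n, ∑ j : Fin k, ENNReal.ofReal (2 * Real.exp (-(t / (2 * b)))) :=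
        Finset.sum_le_sum fun i _ => Finset.sum_le_sum fun j _ => by
          rw [laplaceNoise_apply_mem hb i j hs]
          exact laplaceMeasure_abs_gt_le hb t
    _ = _ := by
        simp only [Finset.sum_const, Finset.card_univ, Fintype.card_fin, nsmul_eq_mul]
        rw [← ENNReal.ofReal_natCast, ← ENNReal.ofReal_natCast, ← ENNReal.ofReal_mul (by positivity),
          ← ENNReal.ofReal_mul (by positivity)]
        ring_nf

theorem le_laplaceMeasure_Icc {b : ℝ} (hb : 0 < b) (α x : ℝ) :
    ENNReal.ofReal (α / b * Real.exp (-(|x| + α) / b)) ≤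
      laplaceMeasure b (Set.Icc (x - α) (x + α)) := by
  rw [laplaceMeasure, withDensity_apply _ measurableSet_Icc]
  calc _ = ∫⁻ _ in Set.Icc (x - α) (x + α),
          ENNReal.ofReal (Real.exp (-(|x| + α) / b) / (2 * b)) := by
        rw [setLIntegral_const, Real.volume_Icc, ← ENNReal.ofReal_mul (by positivity)]
        congr 1
        field_simp
        ring
    _ ≤ _ := by
        refine setLIntegral_mono (measurable_laplacePDF b).ennreal_ofReal fun y hy => ?_
        refine ENNReal.ofReal_le_ofReal ?_
        unfold laplacePDF
        have : |y| ≤ |x| + α := by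
          have h1 : |y - x| ≤ α := abs_le.2 ⟨by linarith [hy.1], by linarith [hy.2]⟩
          have h2 := abs_add_le x (y - x)
          rw [add_sub_cancel] at h2
          linarith
        gcongr

end LaplaceVector

/-! ### Sensitivity of empirical means on disjoint events. -/

section EmpiricalMean

variable {Z : Type*} {k m : ℕ}

/-- The empirical means over the sample `S` of the coordinates of `φ` restricted to `E`. -/
noncomputable def empiricalMean (φ : Z → Fin k → ℝ) (S : Fin m → Z) (E : Set Z) (j : Fin k) : ℝ :=
  (∑ s, φ (S s) j * E.indicator (fun _ => (1 : ℝ)) (S s)) / m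

theorem stdSimplex_coord_mem_Icc {φ : Z → Fin k → ℝ} (hΔ : ∀ z, φ z ∈ stdSimplex ℝ (Fin k))
    (z : Z) (j : Fin k) : φ z j ∈ Set.Icc (0 : ℝ) 1 :=
  ⟨(hΔ z).1 j, (Finset.single_le_sum (fun i _ => (hΔ z).1 i) (Finset.mem_univ j)).trans_eq (hΔ z).2⟩

theorem mul_indicator_mem_Icc {φ : Z → Fin k → ℝ} (hΔ : ∀ z, φ z ∈ stdSimplex ℝ (Fin k))
    (E : Set Z) (j : Fin k) (z : Z) :
    φ z j * E.indicator (fun _ => (1 : ℝ)) z ∈ Set.Icc (0 : ℝ) 1 := by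
  have h := stdSimplex_coord_mem_Icc hΔ z j
  by_cases hz : z ∈ E
  · simpa [hz] using h
  · simp [hz]

/-- The coordinates of φ sum to one, and z lies in at most one of the events. This is what keeps the
total sensitivity independent of n and k. -/
theorem sum_sum_mul_indicator_le_one {n : ℕ} {φ : Z → Fin k → ℝ}
    (hΔ : ∀ z, φ z ∈ stdSimplex ℝ (Fin k)) {E : Fin n → Set Z}
    (hE : ∀ i j, i < j → Disjoint (E i) (E j)) (z : Z) :
    ∑ i, ∑ j, φ z j * (E i).indicator (fun _ => (1 : ℝ)) z ≤ 1 := by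
  have h : ∀ i, ∑ j, φ z j * (E i).indicator (fun _ => (1 : ℝ)) z =
      (E i).indicator (fun _ => (1 : ℝ)) z := fun i => by
    rw [← Finset.sum_mul, (hΔ z).2, one_mul]
  simp_rw [h]
  by_cases hz : ∃ i, z ∈ E i
  · obtain ⟨i, hi⟩ := hz
    rw [Finset.sum_eq_single i]
    · simp [hi]
    · intro j _ hji
      refine Set.indicator_of_notMem (fun hj => ?_) _
      rcases lt_or_gt_of_ne hji with h' | h'
      · exact Set.disjoint_left.1 (hE j i h') hj hi
      · exact Set.disjoint_left.1 (hE i j h') hi hj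
    · simp
  · push Not at hz
    simp [hz]

/-- The empirical means on disjoint events have total sensitivity at most `2 / m`. -/
theorem sum_abs_empiricalMean_sub_update_le {n : ℕ} {φ : Z → Fin k → ℝ}
    (hΔ : ∀ z, φ z ∈ stdSimplex ℝ (Fin k)) {E : Fin n → Set Z}
    (hE : ∀ i j, i < j → Disjoint (E i) (E j)) (S : Fin m → Z) (s : Fin m) (z : Z) :
    ∑ i, ∑ j, |empiricalMean φ (Function.update S s z) (E i) j - empiricalMean φ S (E i) j| ≤
      2 / m := by
  have hdiff : ∀ h : Z → ℝ, ∑ t, h (Function.update S s z t) - ∑ t, h (S t) = h z - h (S s) :=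
    fun h => by
      rw [← Finset.sum_sub_distrib, Finset.sum_eq_single s]
      · simp
      · intro t _ hts
        simp [hts]
      · simp
  have hterm : ∀ i j, |empiricalMean φ (Function.update S s z) (E i) j -
      empiricalMean φ S (E i) j| ≤ (φ z j * (E i).indicator (fun _ => (1 : ℝ)) z +
        φ (S s) j * (E i).indicator (fun _ => (1 : ℝ)) (S s)) / m := fun i j => by
    unfold empiricalMean
    rw [← sub_div, hdiff fun z => φ z j * (E i).indicator (fun _ => (1 : ℝ)) z, abs_div,
      Nat.abs_cast]
    gcongr
    have h1 := (mul_indicator_mem_Icc hΔ (E i) j z).1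
    have h2 := (mul_indicator_mem_Icc hΔ (E i) j (S s)).1
    exact abs_le.2 ⟨by linarith, by linarith⟩
  refine (Finset.sum_le_sum fun i _ => Finset.sum_le_sum fun j _ => hterm i j).trans ?_
  simp_rw [← Finset.sum_div, Finset.sum_add_distrib]
  gcongr
  linarith [sum_sum_mul_indicator_le_one hΔ hE z, sum_sum_mul_indicator_le_one hΔ hE (S s)]

end EmpiricalMean

/-! ### The Laplace estimator and its interaction with an adaptive algorithm. -/

section LaplaceEstimator

variable {R Z : Type*} [MeasurableSpace R] [MeasurableSpace Z] {n k m : ℕ}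

/-- The estimator that adds independent Laplace noise to the empirical means. -/
noncomputable abbrev laplaceEstimator (φ : Z → Fin k → ℝ) (n m : ℕ) (b : ℝ) (hb : 0 < b) :
    OnlineEstimator Z n k m where
  Seed := Fin n → Fin k → ℝ
  seedLaw := laplaceNoise n k b
  isProbabilityMeasure_seedLaw := isProbabilityMeasure_laplaceNoise hb
  answer ω S i E := empiricalMean φ S (E (Fin.last i)) + ω i

/-- The empirical means on the event that `A` selects in round `i` after the estimates `a`. -/
noncomputable def selectedMean (φ : Z → Fin k → ℝ) (A : AdaptiveSelector R Z n k) (r : R)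
    (S : Fin m → Z) (i : Fin n) (a : Fin i.val → Fin k → ℝ) : Fin k → ℝ :=
  empiricalMean φ S (A.select r i a)

theorem interactionEstimate_laplaceEstimator (φ : Z → Fin k → ℝ) (A : AdaptiveSelector R Z n k)
    {b : ℝ} (hb : 0 < b) (r : R) (S : Fin m → Z) (ω : Fin n → Fin k → ℝ) (i : Fin n) :
    interactionEstimate A (laplaceEstimator φ n m b hb) r S ω i =
      selectedMean φ A r S i (fun q =>
        interactionEstimate A (laplaceEstimator φ n m b hb) r S ω ⟨q, q.isLt.trans i.isLt⟩) +
        ω i := by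
  rw [interactionEstimate]
  rfl

/-- The noise that produces the transcript a is a minus the empirical means selected along a;
induction on rounds shows that the interaction run with this noise reproduces a. It supplies the
inversion hypothesis of `measure_transcript_mem_le`. -/
theorem interactionEstimate_triangularShear (φ : Z → Fin k → ℝ) (A : AdaptiveSelector R Z n k)
    {b : ℝ} (hb : 0 < b) (r : R) (S : Fin m → Z) (a : Fin n → Fin k → ℝ) (i : Fin n) :
    interactionEstimate A (laplaceEstimator φ n m b hb) r S
      (triangularShear (selectedMean φ A r S) a) i = a i := by
  induction hi : i.val using Nat.strong_induction_on generalizing i with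
  | _ l ih =>
    subst hi
    rw [interactionEstimate_laplaceEstimator]
    have : (fun q : Fin i.val => interactionEstimate A (laplaceEstimator φ n m b hb) r S
        (triangularShear (selectedMean φ A r S) a) ⟨q, q.isLt.trans i.isLt⟩) =
        fun q : Fin i.val => a ⟨q, q.isLt.trans i.isLt⟩ :=
      funext fun q => ih q.val q.isLt _ rfl
    rw [this, triangularShear, add_sub_cancel]

theorem measurable_indicator_select (A : AdaptiveSelector R Z n k) (i : Fin n) :
    Measurable fun p : R × (Fin i.val → Fin k → ℝ) × Z =>
      (A.select p.1 i p.2.1).indicator (fun _ => (1 : ℝ)) p.2.2 := by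
  have h : Measurable ({p : R × (Fin i.val → Fin k → ℝ) × Z |
      p.2.2 ∈ A.select p.1 i p.2.1}.indicator fun _ => (1 : ℝ)) :=
    measurable_const.indicator (A.measurableSet_select i)
  have h' : ∀ p : R × (Fin i.val → Fin k → ℝ) × Z,
      (A.select p.1 i p.2.1).indicator (fun _ => (1 : ℝ)) p.2.2 =
        {p : R × (Fin i.val → Fin k → ℝ) × Z | p.2.2 ∈ A.select p.1 i p.2.1}.indicator
          (fun _ => (1 : ℝ)) p := fun p => by
    by_cases hp : p.2.2 ∈ A.select p.1 i p.2.1 <;> simp [hp]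
  simpa only [h'] using h

theorem measurable_selectedMean {φ : Z → Fin k → ℝ} (hφ : Measurable φ)
    (A : AdaptiveSelector R Z n k) (i : Fin n) :
    Measurable fun p : R × (Fin m → Z) × (Fin i.val → Fin k → ℝ) =>
      selectedMean φ A p.1 p.2.1 i p.2.2 := by
  refine measurable_pi_lambda _ fun j => ?_
  unfold selectedMean empiricalMean
  refine (Finset.measurable_fun_sum _ fun s _ => Measurable.mul ?_ ?_).div_const _
  · have : Measurable fun p : R × (Fin m → Z) × (Fin i.val → Fin k → ℝ) => p.2.1 s := by fun_prop
    exact (measurable_pi_apply j).comp (hφ.comp this)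
  · have : Measurable fun p : R × (Fin m → Z) × (Fin i.val → Fin k → ℝ) =>
        (p.1, p.2.2, p.2.1 s) := by fun_prop
    exact (measurable_indicator_select A i).comp this

theorem measurable_integral_select {φ : Z → Fin k → ℝ} (hφ : Measurable φ)
    (A : AdaptiveSelector R Z n k) (D : Measure Z) [IsProbabilityMeasure D] (i : Fin n)
    (j : Fin k) :
    Measurable fun p : R × (Fin i.val → Fin k → ℝ) =>
      ∫ z, φ z j * (A.select p.1 i p.2).indicator (fun _ => (1 : ℝ)) z ∂D := by
  have h : Measurable fun q : (R × (Fin i.val → Fin k → ℝ)) × Z =>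
      φ q.2 j * (A.select q.1.1 i q.1.2).indicator (fun _ => (1 : ℝ)) q.2 := by
    refine ((measurable_pi_apply j).comp (hφ.comp measurable_snd)).mul ?_
    have : Measurable fun q : (R × (Fin i.val → Fin k → ℝ)) × Z => (q.1.1, q.1.2, q.2) := by
      fun_prop
    exact (measurable_indicator_select A i).comp this
  exact h.stronglyMeasurable.integral_prod_right.measurable

theorem measurable_interactionEstimate_laplaceEstimator {φ : Z → Fin k → ℝ} (hφ : Measurable φ)
    (A : AdaptiveSelector R Z n k) {b : ℝ} (hb : 0 < b) (i : Fin n) :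
    Measurable fun p : R × (Fin m → Z) × (Fin n → Fin k → ℝ) =>
      interactionEstimate A (laplaceEstimator φ n m b hb) p.1 p.2.1 p.2.2 i := by
  induction hi : i.val using Nat.strong_induction_on generalizing i with
  | _ l ih =>
    subst hi
    rw [funext fun p : R × (Fin m → Z) × (Fin n → Fin k → ℝ) =>
      interactionEstimate_laplaceEstimator φ A hb p.1 p.2.1 p.2.2 i]
    refine Measurable.add ?_ (by fun_prop)
    have h : Measurable fun p : R × (Fin m → Z) × (Fin n → Fin k → ℝ) =>
        fun q : Fin i.val => interactionEstimate A (laplaceEstimator φ n m b hb) p.1 p.2.1 p.2.2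
          ⟨q, q.isLt.trans i.isLt⟩ :=
      measurable_pi_lambda _ fun q => ih q q.isLt _ rfl
    have h' : Measurable fun p : R × (Fin m → Z) × (Fin n → Fin k → ℝ) => (p.1, p.2.1,
        fun q : Fin i.val => interactionEstimate A (laplaceEstimator φ n m b hb) p.1 p.2.1 p.2.2
          ⟨q, q.isLt.trans i.isLt⟩) :=
      measurable_fst.prodMk ((measurable_fst.comp measurable_snd).prodMk h)
    exact (measurable_selectedMean hφ A i).comp h'

/-- The deviation between the empirical and the true mean, on the events selected along the
transcript `a`. -/
noncomputable def selectedDeviation (φ : Z → Fin k → ℝ) (A : AdaptiveSelector R Z n k)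
    (D : Measure Z) (r : R) (S : Fin m → Z) (a : Fin n → Fin k → ℝ) (i : Fin n) (j : Fin k) : ℝ :=
  selectedMean φ A r S i (fun q => a ⟨q, q.isLt.trans i.isLt⟩) j -
    ∫ z, φ z j * (A.select r i fun q => a ⟨q, q.isLt.trans i.isLt⟩).indicator
      (fun _ => (1 : ℝ)) z ∂D

theorem measurable_selectedDeviation {φ : Z → Fin k → ℝ} (hφ : Measurable φ)
    (A : AdaptiveSelector R Z n k) (D : Measure Z) [IsProbabilityMeasure D] (i : Fin n)
    (j : Fin k) :
    Measurable fun p : R × (Fin m → Z) × (Fin n → Fin k → ℝ) =>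
      selectedDeviation φ A D p.1 p.2.1 p.2.2 i j := by
  have h1 : Measurable fun p : R × (Fin m → Z) × (Fin n → Fin k → ℝ) =>
      (p.1, p.2.1, fun q : Fin i.val => p.2.2 ⟨q, q.isLt.trans i.isLt⟩) := by fun_prop
  have h2 : Measurable fun p : R × (Fin m → Z) × (Fin n → Fin k → ℝ) =>
      (p.1, fun q : Fin i.val => p.2.2 ⟨q, q.isLt.trans i.isLt⟩) := by fun_prop
  exact ((measurable_pi_apply j).comp ((measurable_selectedMean hφ A i).comp h1)).sub
    ((measurable_integral_select hφ A D i j).comp h2)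

theorem interactionEstimate_sub_integral (φ : Z → Fin k → ℝ) (A : AdaptiveSelector R Z n k)
    (D : Measure Z) {b : ℝ} (hb : 0 < b) (r : R) (S : Fin m → Z) (ω : Fin n → Fin k → ℝ)
    (i : Fin n) (j : Fin k) :
    interactionEstimate A (laplaceEstimator φ n m b hb) r S ω i j -
      ∫ z, φ z j * (interactionEvent A (laplaceEstimator φ n m b hb) r S ω i).indicator
        (fun _ => (1 : ℝ)) z ∂D =
      selectedDeviation φ A D r S (interactionEstimate A (laplaceEstimator φ n m b hb) r S ω) i j +
        ω i j := by
  rw [interactionEstimate_laplaceEstimator, Pi.add_apply, selectedDeviation, interactionEvent]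
  ring

theorem measure_exists_selectedDeviation_le {φ : Z → Fin k → ℝ} (hφ : Measurable φ)
    (hΔ : ∀ z, φ z ∈ stdSimplex ℝ (Fin k)) (A : AdaptiveSelector R Z n k) (D : Measure Z)
    [IsProbabilityMeasure D] (hm : 0 < m) (r : R) (a : Fin n → Fin k → ℝ) {t : ℝ} (ht : 0 ≤ t) :
    (Measure.pi fun _ : Fin m => D) {S | ∃ i j, t < |selectedDeviation φ A D r S a i j|} ≤
      ENNReal.ofReal (2 * (n * k) * Real.exp (-(2 * m * t ^ 2))) := by
  have hset : {S : Fin m → Z | ∃ i j, t < |selectedDeviation φ A D r S a i j|} =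
      ⋃ i, ⋃ j, {S | t < |selectedDeviation φ A D r S a i j|} := by
    ext S; simp
  rw [hset]
  calc _ ≤ ∑ i : Fin n, ∑ j : Fin k, (Measure.pi fun _ : Fin m => D)
          {S | t < |selectedDeviation φ A D r S a i j|} :=
        (measure_iUnion_fintype_le _ _).trans
          (Finset.sum_le_sum fun i _ => measure_iUnion_fintype_le _ _)
    _ ≤ ∑ i : Fin n, ∑ j : Fin k, ENNReal.ofReal (2 * Real.exp (-(2 * m * t ^ 2))) := by
        refine Finset.sum_le_sum fun i _ => Finset.sum_le_sum fun j _ => ?_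
        refine measure_abs_mean_sub_integral_le D (g := fun z => φ z j * (A.select r i fun q =>
          a ⟨q, q.isLt.trans i.isLt⟩).indicator (fun _ => (1 : ℝ)) z) ?_
          (mul_indicator_mem_Icc hΔ _ j) hm ht
        refine ((measurable_pi_apply j).comp hφ).mul ?_
        have : Measurable fun z : Z => (r, (fun q : Fin i.val => a ⟨q, q.isLt.trans i.isLt⟩), z) :=
          by fun_prop
        exact (measurable_indicator_select A i).comp this
    _ = _ := by
        simp only [Finset.sum_const, Finset.card_univ, Fintype.card_fin, nsmul_eq_mul]
        rw [← ENNReal.ofReal_natCast, ← ENNReal.ofReal_natCast, ← ENNReal.ofReal_mul (by positivity),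
          ← ENNReal.ofReal_mul (by positivity)]
        ring_nf

theorem measure_exists_selectedDeviation_interaction_le {φ : Z → Fin k → ℝ} (hφ : Measurable φ)
    (hΔ : ∀ z, φ z ∈ stdSimplex ℝ (Fin k)) (A : AdaptiveSelector R Z n k) (D : Measure Z)
    [IsProbabilityMeasure D] (hm : 0 < m) {b ε : ℝ} (hb : 0 < b) (hε : 2 / m ≤ ε * b) (r : R)
    {t : ℝ} (ht : 0 ≤ t) :
    ((Measure.pi fun _ : Fin m => D).prod (laplaceNoise n k b))
      {q | ∃ i j, t < |selectedDeviation φ A D r q.1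
        (interactionEstimate A (laplaceEstimator φ n m b hb) r q.1 q.2) i j|} ≤
      ENNReal.ofReal (√(2 * (n * k)) * Real.exp (-(m * t ^ 2)) * Real.exp (m * ε ^ 2 / 4)) := by
  rw [laplaceNoise_eq_withDensity hb, ENNReal.ofReal_mul (by positivity)]
  have hsec : Measurable fun q : (Fin m → Z) × (Fin n → Fin k → ℝ) => (r, q.1, q.2) := by fun_prop
  refine measure_transcript_mem_le D (g := selectedMean φ A r) (ε := ε) (fun i => ?_)
    (measurable_laplaceNoisePDF b) (lintegral_laplaceNoisePDF hb) (fun a S s z => ?_)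
    (T := fun S ω => interactionEstimate A (laplaceEstimator φ n m b hb) r S ω) ?_
    (fun S a => funext fun i => interactionEstimate_triangularShear φ A hb r S a i)
    (G := {q | ∃ i j, t < |selectedDeviation φ A D r q.1 q.2 i j|}) ?_ (fun a => ?_) ?_
  · have h : Measurable fun p : (Fin m → Z) × (Fin i.val → Fin k → ℝ) => (r, p.1, p.2) := by
      fun_prop
    exact (measurable_selectedMean hφ A i).comp h
  -- At a fixed transcript the events do not depend on the sample, so the two noise arrays differ
  -- exactly by the change in the empirical means.
  · refine laplaceNoisePDF_le_exp_mul hb (le_trans (le_of_eq ?_)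
      ((sum_abs_empiricalMean_sub_update_le hΔ (A.disjoint_select r a) S s z).trans hε))
    refine Finset.sum_congr rfl fun i _ => Finset.sum_congr rfl fun j _ => ?_
    simp [triangularShear, selectedMean]
  · exact measurable_pi_lambda _ fun i =>
      (measurable_interactionEstimate_laplaceEstimator hφ A hb i).comp hsec
  · have : {q : (Fin m → Z) × (Fin n → Fin k → ℝ) |
        ∃ i j, t < |selectedDeviation φ A D r q.1 q.2 i j|} =
        ⋃ i, ⋃ j, {q | t < |selectedDeviation φ A D r q.1 q.2 i j|} := by
      ext q; simp
    rw [this]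
    refine MeasurableSet.iUnion fun i => MeasurableSet.iUnion fun j =>
      measurableSet_lt measurable_const (measurable_norm.comp
        ((measurable_selectedDeviation hφ A D i j).comp hsec))
  -- The union bound 2nk exp(−2mt²) is the square of p = √(2nk) exp(−mt²).
  · refine (measure_exists_selectedDeviation_le hφ hΔ A D hm r a ht).trans (le_of_eq ?_)
    rw [← ENNReal.ofReal_pow (by positivity), mul_pow, Real.sq_sqrt (by positivity),
      ← Real.exp_nat_mul]
    push_cast
    ring_nf
  · rw [← ENNReal.ofReal_pow (Real.cosh_pos _).le, ← ENNReal.ofReal_pow (by positivity)]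
    refine ENNReal.ofReal_le_ofReal ?_
    calc Real.cosh ε ^ m ≤ Real.exp (ε ^ 2 / 2) ^ m := by
          gcongr
          exact Real.cosh_le_exp_half_sq ε
      _ = _ := by
          rw [← Real.exp_nat_mul, ← Real.exp_nat_mul]
          push_cast
          ring_nf

end LaplaceEstimator

/-! ### Failure probabilities in the general case and for a single query. -/

section Accuracy

variable {R Z : Type*} [MeasurableSpace R] [MeasurableSpace Z] {n k m : ℕ}

/-- The interactions with the Laplace estimator in which some estimate is off by more than `α`. -/
def laplaceFailure (φ : Z → Fin k → ℝ) (A : AdaptiveSelector R Z n k) (D : Measure Z) (m : ℕ)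
    {b : ℝ} (hb : 0 < b) (α : ℝ) : Set (R × (Fin m → Z) × (Fin n → Fin k → ℝ)) :=
  {p | ∃ (i : Fin n) (j : Fin k),
    α < |interactionEstimate A (laplaceEstimator φ n m b hb) p.1 p.2.1 p.2.2 i j -
      ∫ z, φ z j * (interactionEvent A (laplaceEstimator φ n m b hb) p.1 p.2.1 p.2.2 i).indicator
        (fun _ => (1 : ℝ)) z ∂D|}

theorem measurable_selectedDeviation_interaction {φ : Z → Fin k → ℝ} (hφ : Measurable φ)
    (A : AdaptiveSelector R Z n k) (D : Measure Z) [IsProbabilityMeasure D] {b : ℝ} (hb : 0 < b)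
    (i : Fin n) (j : Fin k) :
    Measurable fun p : R × (Fin m → Z) × (Fin n → Fin k → ℝ) =>
      selectedDeviation φ A D p.1 p.2.1
        (interactionEstimate A (laplaceEstimator φ n m b hb) p.1 p.2.1 p.2.2) i j := by
  have h : Measurable fun p : R × (Fin m → Z) × (Fin n → Fin k → ℝ) =>
      (p.1, p.2.1, interactionEstimate A (laplaceEstimator φ n m b hb) p.1 p.2.1 p.2.2) :=
    measurable_fst.prodMk ((measurable_fst.comp measurable_snd).prodMk
      (measurable_pi_lambda _ fun i => measurable_interactionEstimate_laplaceEstimator hφ A hb i))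
  exact (measurable_selectedDeviation hφ A D i j).comp h

theorem measure_prod_le_of_forall_section {Ω : Type*} [MeasurableSpace Ω] (ρ : Measure R)
    [IsProbabilityMeasure ρ] (ν : Measure Ω) [SFinite ν] {B : Set (R × Ω)} (hB : MeasurableSet B)
    {c : ℝ≥0∞} (h : ∀ r, ν (Prod.mk r ⁻¹' B) ≤ c) : (ρ.prod ν) B ≤ c := by
  rw [Measure.prod_apply hB]
  exact (lintegral_mono h).trans_eq (by simp)

theorem le_measure_prod_of_forall_section {Ω : Type*} [MeasurableSpace Ω] (ρ : Measure R)
    [IsProbabilityMeasure ρ] (ν : Measure Ω) [SFinite ν] {B : Set (R × Ω)} (hB : MeasurableSet B)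
    {c : ℝ≥0∞} (h : ∀ r, c ≤ ν (Prod.mk r ⁻¹' B)) : c ≤ (ρ.prod ν) B := by
  rw [Measure.prod_apply hB]
  exact le_trans (by simp) (lintegral_mono h)

theorem measure_laplaceFailure_le_add {φ : Z → Fin k → ℝ} (hφ : Measurable φ)
    (hΔ : ∀ z, φ z ∈ stdSimplex ℝ (Fin k)) (A : AdaptiveSelector R Z n k) (D : Measure Z)
    [IsProbabilityMeasure D] (ρ : Measure R) [IsProbabilityMeasure ρ] (hm : 0 < m) {b ε : ℝ}
    (hb : 0 < b) (hε : 2 / m ≤ ε * b) {t : ℝ} (ht : 0 ≤ t) :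
    (ρ.prod ((Measure.pi fun _ : Fin m => D).prod (laplaceNoise n k b)))
      (laplaceFailure φ A D m hb (2 * t)) ≤
      ENNReal.ofReal (2 * (n * k) * Real.exp (-(t / (2 * b)))) +
      ENNReal.ofReal (√(2 * (n * k)) * Real.exp (-(m * t ^ 2)) * Real.exp (m * ε ^ 2 / 4)) := by
  have := isProbabilityMeasure_laplaceNoise (n := n) (k := k) hb
  set N : Set (R × (Fin m → Z) × (Fin n → Fin k → ℝ)) := {p | ∃ i j, t < |p.2.2 i j|}
  set B : Set (R × (Fin m → Z) × (Fin n → Fin k → ℝ)) := {p | ∃ i j, t < |selectedDeviation φ A D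
    p.1 p.2.1 (interactionEstimate A (laplaceEstimator φ n m b hb) p.1 p.2.1 p.2.2) i j|} with hBdef
  have hsub : laplaceFailure φ A D m hb (2 * t) ⊆ N ∪ B := by
    rintro ⟨r, S, ω⟩ ⟨i, j, hij⟩
    rw [interactionEstimate_sub_integral] at hij
    by_contra hnot
    simp only [N, B, Set.mem_union, Set.mem_ofPred_eq, not_or, not_exists, not_lt] at hnot
    exact absurd ((hij.trans_le (abs_add_le _ _)).trans_le
      (add_le_add (hnot.2 i j) (hnot.1 i j))) (by linarith)
  refine (measure_mono hsub).trans ((measure_union_le _ _).trans (add_le_add ?_ ?_))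
  · have hN : MeasurableSet {ω : Fin n → Fin k → ℝ | ∃ i j, t < |ω i j|} := by
      have : {ω : Fin n → Fin k → ℝ | ∃ i j, t < |ω i j|} = ⋃ i, ⋃ j, {ω | t < |ω i j|} := by
        ext ω; simp
      rw [this]
      have hij : ∀ i j, Measurable fun ω : Fin n → Fin k → ℝ => ω i j := fun i j => by fun_prop
      exact .iUnion fun i => .iUnion fun j => measurableSet_lt measurable_const
        (measurable_norm.comp (hij i j))
    have hproj := (measurePreserving_snd (μ := Measure.pi fun _ : Fin m => D)
      (ν := laplaceNoise n k b)).comp (measurePreserving_snd (μ := ρ)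
        (ν := (Measure.pi fun _ : Fin m => D).prod (laplaceNoise n k b)))
    have h := hproj.measure_preimage hN.nullMeasurableSet
    exact h.le.trans (laplaceNoise_exists_abs_gt_le hb t)
  · have hB : MeasurableSet B := by
      have : B = ⋃ i, ⋃ j, {p | t < |selectedDeviation φ A D p.1 p.2.1
          (interactionEstimate A (laplaceEstimator φ n m b hb) p.1 p.2.1 p.2.2) i j|} := by
        ext p; simp [hBdef]
      rw [this]
      exact .iUnion fun i => .iUnion fun j => measurableSet_lt measurable_const
        (measurable_norm.comp (measurable_selectedDeviation_interaction hφ A D hb i j))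
    exact measure_prod_le_of_forall_section ρ _ hB fun r =>
      measure_exists_selectedDeviation_interaction_le hφ hΔ A D hm hb hε r ht

theorem measure_laplaceFailure_le {φ : Z → Fin k → ℝ} (hφ : Measurable φ)
    (hΔ : ∀ z, φ z ∈ stdSimplex ℝ (Fin k)) (A : AdaptiveSelector R Z n k) (D : Measure Z)
    [IsProbabilityMeasure D] (ρ : Measure R) [IsProbabilityMeasure ρ] (hn : 0 < n) (hk : 0 < k)
    (hm : 0 < m) {α δ : ℝ} (hα : 0 < α) (hδ : 0 < δ) (hδ1 : δ < 1)
    (hmα : 32 * Real.log (2 * (n * k) / δ) ≤ m * α ^ 2) (hb : 0 < 4 / (α * m)) :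
    (ρ.prod ((Measure.pi fun _ : Fin m => D).prod (laplaceNoise n k (4 / (α * m)))))
      (laplaceFailure φ A D m hb α) ≤ ENNReal.ofReal δ := by
  have hm' : (0 : ℝ) < m := by exact_mod_cast hm
  have hnk : (1 : ℝ) ≤ n * k := by exact_mod_cast Nat.mul_pos hn hk
  -- With b = 4/(αm), the choice ε = α/2 makes εb exactly 2/m; t = α/2 splits the allowed error
  -- evenly between noise and sampling.
  have h := measure_laplaceFailure_le_add hφ hΔ A D ρ hm (ε := α / 2) hb
    (le_of_eq (by field_simp; norm_num)) (t := α / 2) (by positivity)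
  rw [mul_div_cancel₀ α two_ne_zero] at h
  refine h.trans ?_
  rw [← ENNReal.ofReal_add (by positivity) (by positivity)]
  refine ENNReal.ofReal_le_ofReal ?_
  set x : ℝ := 2 * (n * k) with hx
  have hx2 : 2 ≤ x := by linarith
  set y : ℝ := δ / x with hy
  have hy0 : 0 < y := by positivity
  have hxy : x * y = δ := by rw [hy]; field_simp
  have hlog : Real.exp (-Real.log (x / δ)) = y := by
    rw [Real.exp_neg, Real.exp_log (by positivity), inv_div]
  -- The constant 32 lifts the exponent mα²/16 to 2 log(x/δ). Of the resulting y², one factor turns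
  -- the union bound x into δ, and the other, at most 1/2, leaves room for adding two failure terms.
  have hexp : ∀ c : ℝ, 2 * Real.log (x / δ) ≤ c → Real.exp (-c) ≤ y ^ 2 := fun c hc => by
    rw [← hlog, ← Real.exp_nat_mul, Real.exp_le_exp]
    push_cast
    linarith
  have h1 : x * Real.exp (-(α / 2 / (2 * (4 / (α * m))))) ≤ x * y ^ 2 := by
    gcongr
    refine hexp _ ?_
    have : α / 2 / (2 * (4 / (α * m))) = m * α ^ 2 / 16 := by field_simp; norm_num
    rw [this]
    linarith
  have h2 : √x * Real.exp (-(m * (α / 2) ^ 2)) * Real.exp (m * (α / 2) ^ 2 / 4) ≤ x * y ^ 2 := by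
    rw [mul_assoc, ← Real.exp_add]
    have hs : √x ≤ x := Real.sqrt_le_iff.2 ⟨by linarith, by nlinarith⟩
    -- The gain mα²/4 from Hoeffding outweighs the reweighting cost mα²/16.
    have : -(m * (α / 2) ^ 2) + m * (α / 2) ^ 2 / 4 = -(3 * (m * α ^ 2) / 16) := by ring
    rw [this]
    have hl : 0 ≤ Real.log (x / δ) := Real.log_nonneg (by rw [le_div_iff₀ hδ]; linarith)
    gcongr
    exact hexp _ (by linarith)
  have h3 : x * y ^ 2 = δ * y := by rw [← hxy]; ring
  have h4 : 2 * y ≤ δ := by rw [← hxy]; gcongr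
  nlinarith

theorem measurableSet_laplaceFailure {φ : Z → Fin k → ℝ} (hφ : Measurable φ)
    (A : AdaptiveSelector R Z n k) (D : Measure Z) [IsProbabilityMeasure D] {b : ℝ} (hb : 0 < b)
    (α : ℝ) : MeasurableSet (laplaceFailure φ A D m hb α) := by
  have : laplaceFailure φ A D m hb α = ⋃ i, ⋃ j, {p | α < |selectedDeviation φ A D p.1 p.2.1
      (interactionEstimate A (laplaceEstimator φ n m b hb) p.1 p.2.1 p.2.2) i j + p.2.2 i j|} := by
    ext p
    simp only [laplaceFailure, interactionEstimate_sub_integral, Set.mem_iUnion, Set.mem_ofPred_eq]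
  rw [this]
  refine .iUnion fun i => .iUnion fun j => measurableSet_lt measurable_const
    (measurable_norm.comp ((measurable_selectedDeviation_interaction hφ A D hb i j).add ?_))
  fun_prop

/-- For a single real-valued query, Laplace noise of the scale `1 / √m` of the sampling error
makes the estimate `α`-accurate with probability of the order of `α * √m` even when `α` is much
smaller than the sampling error. -/
theorem measure_laplaceFailure_one_le {φ : Z → Fin 1 → ℝ} (hφ : Measurable φ)
    (hΔ : ∀ z, φ z ∈ stdSimplex ℝ (Fin 1)) (A : AdaptiveSelector R Z 1 1) (D : Measure Z)
    [IsProbabilityMeasure D] (ρ : Measure R) [IsProbabilityMeasure ρ] (hm : 0 < m) {α : ℝ}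
    (hα : 0 < α) (hb : 0 < 1 / √(m : ℝ)) :
    (ρ.prod ((Measure.pi fun _ : Fin m => D).prod (laplaceNoise 1 1 (1 / √(m : ℝ)))))
      (laplaceFailure φ A D m hb α) ≤
      ENNReal.ofReal (1 - α * √m * Real.exp (-(1 + α * √m)) / 2) := by
  have := isProbabilityMeasure_laplaceNoise (n := 1) (k := 1) hb
  have hm' : (0 : ℝ) < m := by exact_mod_cast hm
  have hsm : 0 < √(m : ℝ) := Real.sqrt_pos.2 hm'
  have hmeas := measurableSet_laplaceFailure (m := m) hφ A D hb α
  set c : ℝ := α * √m * Real.exp (-(1 + α * √m)) with hc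
  have hc0 : 0 < c := by positivity
  have hgood : ENNReal.ofReal (c / 2) ≤
      (ρ.prod ((Measure.pi fun _ : Fin m => D).prod (laplaceNoise 1 1 (1 / √(m : ℝ)))))
        (laplaceFailure φ A D m hb α)ᶜ := by
    refine le_measure_prod_of_forall_section ρ _ hmeas.compl fun r => ?_
    -- In the only round no estimate has been received yet, so the event depends on r alone and the
    -- transcript may be replaced by 0.
    have hdev : ∀ S ω, selectedDeviation φ A D r S
        (interactionEstimate A (laplaceEstimator φ 1 m _ hb) r S ω) 0 0 =
        selectedDeviation φ A D r S 0 0 0 := fun S ω => by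
      have : (fun q : Fin (0 : Fin 1).val => interactionEstimate A (laplaceEstimator φ 1 m _ hb)
          r S ω ⟨q, q.isLt.trans (0 : Fin 1).isLt⟩) =
          fun q : Fin (0 : Fin 1).val =>
            (0 : Fin 1 → Fin 1 → ℝ) ⟨q, q.isLt.trans (0 : Fin 1).isLt⟩ :=
        funext fun q => Fin.elim0 q
      unfold selectedDeviation
      rw [this]
    set d : (Fin m → Z) → ℝ := fun S => selectedDeviation φ A D r S 0 0 0 with hd
    have hdm : Measurable d := by
      have h : Measurable fun S : Fin m → Z => (r, S, (0 : Fin 1 → Fin 1 → ℝ)) := by fun_prop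
      exact (measurable_selectedDeviation hφ A D 0 0).comp h
    have hH : MeasurableSet {S | |d S| ≤ 1 / √(m : ℝ)} :=
      measurableSet_le (measurable_norm.comp hdm) measurable_const
    have hHm : ENNReal.ofReal (1 / 2) ≤
        (Measure.pi fun _ : Fin m => D) {S | |d S| ≤ 1 / √(m : ℝ)} := by
      -- At this threshold Hoeffding leaves a failure probability of at most 2e⁻² ≤ 1/2.
      have h := measure_exists_selectedDeviation_le hφ hΔ A D hm r 0 (t := 1 / √(m : ℝ))
        (by positivity)
      have hcompl : {S | |d S| ≤ 1 / √(m : ℝ)}ᶜ =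
          {S | ∃ i j, 1 / √(m : ℝ) < |selectedDeviation φ A D r S 0 i j|} := by
        ext S
        simp [hd, Fin.exists_fin_one]
      rw [← hcompl, prob_compl_eq_one_sub hH] at h
      have h2 : 2 * (((1 : ℕ) : ℝ) * ((1 : ℕ) : ℝ)) * Real.exp (-(2 * m * (1 / √(m : ℝ)) ^ 2)) ≤
          1 / 2 := by
        have he : -(2 * m * (1 / √(m : ℝ)) ^ 2) = -(1 + 1) := by
          rw [div_pow, Real.sq_sqrt hm'.le]; field_simp; norm_num
        rw [he, Real.exp_neg, Real.exp_add]
        have h2e : 2 ≤ Real.exp 1 := by linarith [Real.add_one_le_exp (1 : ℝ)]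
        have h4 : 4 ≤ Real.exp 1 * Real.exp 1 := by nlinarith
        have := inv_anti₀ (by norm_num) h4
        push_cast
        linarith
      have h3 := h.trans (ENNReal.ofReal_le_ofReal h2)
      rw [tsub_le_iff_right] at h3
      have h5 : ENNReal.ofReal (1 / 2) + ENNReal.ofReal (1 / 2) = 1 := by
        rw [← ENNReal.ofReal_add (by norm_num) (by norm_num)]; norm_num
      rw [← h5] at h3
      exact (ENNReal.add_le_add_iff_left ENNReal.ofReal_ne_top).1 h3
    rw [Measure.prod_apply (hmeas.compl.preimage measurable_prodMk_left)]
    calc ENNReal.ofReal (c / 2)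
        = ENNReal.ofReal c * ENNReal.ofReal (1 / 2) := by
          rw [← ENNReal.ofReal_mul hc0.le]; ring_nf
      _ ≤ ENNReal.ofReal c * (Measure.pi fun _ : Fin m => D) {S | |d S| ≤ 1 / √(m : ℝ)} := by
          gcongr
      _ = ∫⁻ _ in {S | |d S| ≤ 1 / √(m : ℝ)}, ENNReal.ofReal c ∂(Measure.pi fun _ => D) :=
          (setLIntegral_const _ _).symm
      _ ≤ ∫⁻ S in {S | |d S| ≤ 1 / √(m : ℝ)}, laplaceNoise 1 1 (1 / √(m : ℝ))
            (Prod.mk S ⁻¹' (Prod.mk r ⁻¹' (laplaceFailure φ A D m hb α)ᶜ))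
            ∂(Measure.pi fun _ => D) := by
          refine setLIntegral_mono' hH fun S hS => ?_
          have hS' : |d S| ≤ 1 / √(m : ℝ) := hS
          -- The estimate is accurate when the noise cancels the sampling error up to α. As |d S| is
          -- at most the noise scale, this window still has Laplace mass of order α√m.
          have hI : {ω : Fin 1 → Fin 1 → ℝ | ω 0 0 ∈ Set.Icc (-d S - α) (-d S + α)} ⊆
              Prod.mk S ⁻¹' (Prod.mk r ⁻¹' (laplaceFailure φ A D m hb α)ᶜ) := by
            intro ω hω
            have hω' : ω 0 0 ∈ Set.Icc (-d S - α) (-d S + α) := hω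
            rintro ⟨i, j, hij⟩
            rw [Subsingleton.elim i 0, Subsingleton.elim j 0, interactionEstimate_sub_integral,
              hdev] at hij
            refine absurd hij (not_lt.2 (abs_le.2 ⟨?_, ?_⟩))
            · linarith [hω'.1]
            · linarith [hω'.2]
          refine le_trans ?_ (measure_mono hI)
          rw [laplaceNoise_apply_mem hb 0 0 measurableSet_Icc]
          refine le_trans (ENNReal.ofReal_le_ofReal ?_) (le_laplaceMeasure_Icc hb α _)
          rw [hc, div_div_eq_mul_div, div_one, abs_neg, div_div_eq_mul_div, div_one]
          gcongr
          have : |d S| * √m ≤ 1 := by rwa [le_div_iff₀ hsm] at hS'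
          linarith
      _ ≤ _ := setLIntegral_le_lintegral _ _
  have hle : ENNReal.ofReal (c / 2) ≤ 1 := hgood.trans prob_le_one
  rw [prob_compl_eq_one_sub hmeas] at hgood
  rw [ENNReal.ofReal_sub _ (by positivity), ENNReal.ofReal_one]
  have hp : (ρ.prod ((Measure.pi fun _ : Fin m => D).prod (laplaceNoise 1 1 (1 / √(m : ℝ)))))
        (laplaceFailure φ A D m hb α) ≤ 1 := prob_le_one
  exact ENNReal.le_sub_of_add_le_right ENNReal.ofReal_ne_top
    ((add_le_add_right hgood _).trans_eq (by rw [add_tsub_cancel_of_le hp]))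

/-- Used with a = α√m: the success probability is linear in a, while the sample size controls a².
Since (1 − δ)² ≤ 1 − δ ≤ −log δ, taking roots gives 2e(1 − δ) ≤ a with e = exp(1 + √K) ≥ exp(1 + a).
-/
theorem one_sub_le_of_sq_le {K δ a : ℝ} (ha : 0 ≤ a) (haK : a ^ 2 ≤ K) (hδ : 0 < δ)
    (hδ1 : δ < 1) (h : 4 * Real.exp (1 + √K) ^ 2 * -Real.log δ ≤ a ^ 2) :
    1 - δ ≤ a * Real.exp (-(1 + a)) / 2 := by
  have hlog : 1 - δ ≤ -Real.log δ := by linarith [Real.log_le_sub_one_of_pos hδ]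
  set e := Real.exp (1 + √K) with he
  have he0 : 0 < e := Real.exp_pos _
  have hsq : (2 * e * (1 - δ)) ^ 2 ≤ a ^ 2 := by
    refine le_trans ?_ h
    have : (1 - δ) ^ 2 ≤ -Real.log δ := by nlinarith
    calc _ = 4 * e ^ 2 * (1 - δ) ^ 2 := by ring
      _ ≤ _ := by gcongr
  have hle : 2 * e * (1 - δ) ≤ a := le_of_sq_le_sq hsq ha
  have haS : a ≤ √K := Real.le_sqrt_of_sq_le haK
  calc 1 - δ = 2 * e * (1 - δ) * e⁻¹ / 2 := by field_simp
    _ ≤ a * Real.exp (-(1 + a)) / 2 := by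
      rw [he, ← Real.exp_neg]
      gcongr

end Accuracy

/-! ### The main theorem: choice of the constant and of the noise scale. -/

theorem lemma3p4 :
    ∃ C : ℝ, 0 < C ∧
      ∀ (n k : ℕ), 0 < n → 0 < k →
      ∀ (α δ : ℝ), 0 < α → α < 1 → 0 < δ → δ < 1 →
      ∀ m : ℕ, C * (Real.log ((n : ℝ) * (k : ℝ) / δ) / α ^ 2) ≤ (m : ℝ) →
      ∀ (X : Type u) (Y : Type v) [MeasurableSpace X] [MeasurableSpace Y]
        (φ : X × Y → Fin k → ℝ), Measurable φ → (∀ z, φ z ∈ stdSimplex ℝ (Fin k)) →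
      ∃ M : OnlineEstimator (X × Y) n k m,
        ∀ (D : Measure (X × Y)) [IsProbabilityMeasure D]
          (R : Type w) [MeasurableSpace R] (ρ : Measure R) [IsProbabilityMeasure ρ]
          (A : AdaptiveSelector R (X × Y) n k),
          (∀ i : Fin n, Measurable fun p : R × (Fin m → X × Y) × M.Seed =>
            interactionEstimate A M p.1 p.2.1 p.2.2 i) ∧
          (ρ.prod ((Measure.pi fun _ : Fin m => D).prod M.seedLaw))
            {p : R × (Fin m → X × Y) × M.Seed | ∃ (i : Fin n) (j : Fin k),
              α < |interactionEstimate A M p.1 p.2.1 p.2.2 i j -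
                ∫ z, φ z j *
                  (interactionEvent A M p.1 p.2.1 p.2.2 i).indicator (fun _ => (1 : ℝ)) z ∂D|}
            ≤ ENNReal.ofReal δ := by
  -- The value of mα² from which the general bound with n = k = 1 yields failure probability 1/2.
  set K : ℝ := 32 * Real.log (2 / (1 / 2)) with hKdef
  have hK0 : 0 < K := mul_pos (by norm_num) (Real.log_pos (by norm_num))
  -- The summand 64 serves the case nk/δ ≥ 2; the other serves a single query with mα² < K.
  refine ⟨64 + 4 * Real.exp (1 + √K) ^ 2, by positivity, ?_⟩
  intro n k hn hk α δ hα _ hδ hδ1 m hm X Y _ _ φ hφ hΔ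
  have hnk : (1 : ℝ) ≤ n * k := by exact_mod_cast Nat.mul_pos hn hk
  set x : ℝ := n * k / δ with hx
  have hx1 : 1 < x := by rw [hx, lt_div_iff₀ hδ]; linarith
  have hlog : 0 < Real.log x := Real.log_pos hx1
  have hm0 : (0 : ℝ) < m := lt_of_lt_of_le (by positivity) hm
  have hmpos : 0 < m := by exact_mod_cast hm0
  have hmα : (64 + 4 * Real.exp (1 + √K) ^ 2) * Real.log x ≤ m * α ^ 2 := by
    rwa [← mul_div_assoc, div_le_iff₀ (by positivity)] at hm
  have h64 : 64 * Real.log x ≤ m * α ^ 2 := le_trans (by gcongr; simp; positivity) hmα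
  have h4e : 4 * Real.exp (1 + √K) ^ 2 * Real.log x ≤ m * α ^ 2 :=
    le_trans (by gcongr; simp) hmα
  have hb : 0 < 4 / (α * m) := by positivity
  by_cases hx2 : 2 ≤ x
  · refine ⟨laplaceEstimator φ n m (4 / (α * m)) hb, fun D _ R _ ρ _ A =>
      ⟨measurable_interactionEstimate_laplaceEstimator hφ A hb,
        measure_laplaceFailure_le hφ hΔ A D ρ hn hk hmpos hα hδ hδ1 ?_ hb⟩⟩
    -- As x ≥ 2, log(2x) ≤ 2 log x, which turns 32 into 64.
    rw [mul_div_assoc, Real.log_mul two_ne_zero (by positivity)]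
    linarith [Real.log_le_log two_pos hx2]
  · have hδx : n * k = x * δ := by rw [hx]; field_simp
    have hnk2 : n * k < 2 := by
      have : (n * k : ℝ) < 2 := by nlinarith
      exact_mod_cast this
    have hn1 : n = 1 := by nlinarith
    have hk1 : k = 1 := by nlinarith
    subst hn1 hk1
    -- Here n = k = 1 and δ > 1/2, and log(1/δ) may be arbitrarily small, so mα² need not be bounded
    -- below.
    by_cases hmK : K ≤ m * α ^ 2
    · refine ⟨laplaceEstimator φ 1 m (4 / (α * m)) hb, fun D _ R _ ρ _ A =>
        ⟨measurable_interactionEstimate_laplaceEstimator hφ A hb,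
          (measure_laplaceFailure_le hφ hΔ A D ρ hn hk hmpos hα (δ := 1 / 2) (by norm_num)
            (by norm_num) (by simpa [hKdef] using hmK) hb).trans
            (ENNReal.ofReal_le_ofReal ?_)⟩⟩
      have : 1 < 2 * δ := by
        push Not at hx2
        push_cast at hδx
        nlinarith
      linarith
    · have hb' : 0 < 1 / √(m : ℝ) := by positivity
      refine ⟨laplaceEstimator φ 1 m (1 / √(m : ℝ)) hb', fun D _ R _ ρ _ A =>
        ⟨measurable_interactionEstimate_laplaceEstimator hφ A hb',
          (measure_laplaceFailure_one_le hφ hΔ A D ρ hmpos hα hb').trans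
            (ENNReal.ofReal_le_ofReal ?_)⟩⟩
      have hsq : (α * √(m : ℝ)) ^ 2 = m * α ^ 2 := by
        rw [mul_pow, Real.sq_sqrt hm0.le, mul_comm]
      have := one_sub_le_of_sq_le (K := K) (a := α * √(m : ℝ)) (by positivity)
        (by rw [hsq]; exact (not_le.1 hmK).le) hδ hδ1
        (by rw [hsq]; simpa [hx] using h4e)
      linarith
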